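/- **Theorem.** Consider the following sixteen orthonormal four-qubit states $|G_1\rangle,\dots,|G_{16}\rangle\in(\mathbb C^2)^{\otimes 4}$, shared by four parties that hold one qubit each (upper and lower signs are taken together): $$\begin{aligned} |G_{1,2}\rangle&=\tfrac12(|0000\rangle\pm|0111\rangle+|1010\rangle\pm|1101\rangle), & |G_{3,4}\rangle&=\tfrac12(|0000\rangle\pm|0111\rangle-|1010\rangle\mp|1101\rangle),\\ |G_{5,6}\rangle&=\tfrac12(|0001\rangle\pm|0110\rangle+|1011\rangle\pm|1100\rangle), & |G_{7,8}\rangle&=\tfrac12(|0001\rangle\pm|0110\rangle-|1011\rangle\mp|1100\rangle),\\ |G_{9,10}\rangle&=\tfrac12(|0010\rangle\pm|0101\rangle+|1000\rangle\pm|1111\rangle), & |G_{11,12}\rangle&=\tfrac12(|0010\rangle\pm|0101\rangle-|1000\rangle\mp|1111\rangle),\\ |G_{13,14}\rangle&=\tfrac12(|0011\rangle\pm|0100\rangle+|1001\rangle\pm|1110\rangle), & |G_{15,16}\rangle&=\tfrac12(|0011\rangle\pm|0100\rangle-|1001\rangle\mp|1110\rangle). \end{aligned}$$ Let the four parties be grouped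 into laboratories, and let $T$ be a known set of $D$ of these states. For a $k$-element subset $\mathcal S'\subset T$ let $$\rho_{\mathcal S'}=\frac1{k!}\sum_{(\phi_1,\dots,\phi_k)}|\phi_1\rangle\langle\phi_1|\otimes\cdots\otimes|\phi_k\rangle\langle\phi_k|,$$ the sum running over all orderings of the elements of $\mathcal S'$; this is the state that the parties share when the elements of $\mathcal S'$ are distributed in an unknown order, each party receiving its qubit of each of the $k$ states. The set $T$ is called locally $(D,k)$-identifiable for the given grouping if there is a protocol of local operations and classical communication (LOCC) between the laboratories, with finitely many rounds and outcomes and with arbitrary joint operations inside each laboratory, which for every $k$-element subset $\mathcal S'\subset T$ outputs $\mathcal S'$ with probability $1$ when it is run on $\rho_{\mathcal S'}$; otherwise $T$ is locally $(D,k)$-unidentifiable for that grouping. Let $2<D\le 16$ and $1<k<D$ be integers with $\binom Dk>2^{3k}$, and let $T$ be any set of $D$ of the sixteen states. Then $T$ is locally $(D,k)$-unidentifiable in every $1:3$ and in every $2:2$ bipartition of the four parties. Consequently, for an arbitrary grouping of the four parties into laboratories, $T$ is locally $(D,k)$-identifiable if and only if all four parties are in the same laboratory. -/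

import Mathlib

open Matrix

/-- A (finite-round) LOCC protocol for labs `L` with final answers in `O`. The lab `l` holds a
quantum system with orthonormal basis indexed by `X l`. Either the protocol stops and all labs
announce a common answer, or there is one more round: every lab `l` performs a quantum measurement
with `m l` outcomes and Kraus operators `K l i` on its own system (possibly changing the dimension
of the system, so ancillas and partial traces are included), all outcomes are broadcast, and the
continuation may depend on all of them. A lab that does nothing in a round uses the one-outcome
measurement with the identity as its Kraus operator. -/
inductive LOCC (L O : Type) : (L → Type) → Type 1
  | answer {X : L → Type} (o : O) : LOCC L O X
  | round {X : L → Type} [∀ l, DecidableEq (X l)]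
      (m : L → ℕ) (d : ∀ l, Fin (m l) → ℕ)
      (K : ∀ l (i : Fin (m l)), Matrix (Fin (d l i)) (X l) ℂ)
      (complete : ∀ l, ∑ i, (K l i)ᴴ * K l i = 1)
      (next : ∀ j : (∀ l, Fin (m l)), LOCC L O (fun l => Fin (d l (j l)))) : LOCC L O X

/-- The tensor product over all labs of the local operators `K l`. -/
def tensorOp {L : Type} [Fintype L] {X Y : L → Type} (K : ∀ l, Matrix (Y l) (X l) ℂ) :
    Matrix (∀ l, Y l) (∀ l, X l) ℂ :=
  Matrix.of fun y x => ∏ l, K l (y l) (x l)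

/-- The probability that the protocol ends with the answer `o` when it is run on the joint state
with density matrix `ρ`. -/
noncomputable def LOCC.prob {L O : Type} [Fintype L] [DecidableEq L] [DecidableEq O] (o : O) :
    {X : L → Type} → [∀ l, Fintype (X l)] → LOCC L O X →
      Matrix (∀ l, X l) (∀ l, X l) ℂ → ℝ
  | _, _, .answer o', ρ => if o' = o then ρ.trace.re else 0
  | _, _, @LOCC.round _ _ _ _ _ _ K _ next, ρ =>
      ∑ j, LOCC.prob o (next j)
        (tensorOp (fun l => K l (j l)) * ρ * (tensorOp (fun l => K l (j l)))ᴴ)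

/-- Basis labels of the system held by the lab `l` when `k` multi-qubit states are distributed
among the parties `P` and the party `p` works in the lab `lab p`: one bit for each of the `k` states
and each party in `l`. -/
abbrev LabSystem {P L : Type} (lab : P → L) (k : ℕ) (l : L) : Type :=
  Fin k → {p : P // lab p = l} → Fin 2

/-- The vector `ψ (a 0) ⊗ ψ (a 1) ⊗ ⋯ ⊗ ψ (a (k - 1))`, with the qubits grouped according to the
labs. -/
def orderedState {P L ι : Type} (ψ : ι → (P → Fin 2) → ℂ) (lab : P → L) {k : ℕ} (a : Fin k → ι) :
    (∀ l, LabSystem lab k l) → ℂ :=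
  fun x => ∏ c, ψ (a c) (fun p => x (lab p) c ⟨p, rfl⟩)

/-- The density matrix shared by the labs when the `k` states with labels in `s` are distributed in
a uniformly random order. -/
noncomputable def subsetState {P L ι : Type} [DecidableEq ι] (ψ : ι → (P → Fin 2) → ℂ)
    (lab : P → L) (k : ℕ) (s : Finset ι) :
    Matrix (∀ l, LabSystem lab k l) (∀ l, LabSystem lab k l) ℂ :=
  ((k.factorial : ℂ))⁻¹ • ∑ e : Fin k ≃ s,
    Matrix.vecMulVec (orderedState ψ lab fun c => (e c : ι))
      (star (orderedState ψ lab fun c => (e c : ι)))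

/-- The states `ψ i`, `i ∈ T`, are locally `(|T|, k)`-identifiable when the parties are grouped in
labs by `lab`: some LOCC protocol between the labs determines, with certainty, every `k`-element
subset of the states from the `k` states themselves, given in an unknown order. -/
def LocallyIdentifiable {P L ι : Type} [Fintype P] [DecidableEq P] [Fintype L]
    [DecidableEq L] [DecidableEq ι]
    (ψ : ι → (P → Fin 2) → ℂ) (lab : P → L) (T : Finset ι) (k : ℕ) : Prop :=
  ∃ π : LOCC L (Finset ι) (LabSystem lab k),
    ∀ s ∈ T.powersetCard k, π.prob s (subsetState ψ lab k s) = 1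

/-- The computational basis vector `|abcd⟩` of four qubits. -/
def ket4 (a b c d : Fin 2) : (Fin 4 → Fin 2) → ℂ := Pi.single ![a, b, c, d] 1

/-- The sixteen four-qubit states. -/
noncomputable def G4 : Fin 16 → (Fin 4 → Fin 2) → ℂ :=
  ![(1 / 2 : ℂ) • (ket4 0 0 0 0 + ket4 0 1 1 1 + ket4 1 0 1 0 + ket4 1 1 0 1),
    (1 / 2 : ℂ) • (ket4 0 0 0 0 - ket4 0 1 1 1 + ket4 1 0 1 0 - ket4 1 1 0 1),
    (1 / 2 : ℂ) • (ket4 0 0 0 0 + ket4 0 1 1 1 - ket4 1 0 1 0 - ket4 1 1 0 1),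
    (1 / 2 : ℂ) • (ket4 0 0 0 0 - ket4 0 1 1 1 - ket4 1 0 1 0 + ket4 1 1 0 1),
    (1 / 2 : ℂ) • (ket4 0 0 0 1 + ket4 0 1 1 0 + ket4 1 0 1 1 + ket4 1 1 0 0),
    (1 / 2 : ℂ) • (ket4 0 0 0 1 - ket4 0 1 1 0 + ket4 1 0 1 1 - ket4 1 1 0 0),
    (1 / 2 : ℂ) • (ket4 0 0 0 1 + ket4 0 1 1 0 - ket4 1 0 1 1 - ket4 1 1 0 0),
    (1 / 2 : ℂ) • (ket4 0 0 0 1 - ket4 0 1 1 0 - ket4 1 0 1 1 + ket4 1 1 0 0),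
    (1 / 2 : ℂ) • (ket4 0 0 1 0 + ket4 0 1 0 1 + ket4 1 0 0 0 + ket4 1 1 1 1),
    (1 / 2 : ℂ) • (ket4 0 0 1 0 - ket4 0 1 0 1 + ket4 1 0 0 0 - ket4 1 1 1 1),
    (1 / 2 : ℂ) • (ket4 0 0 1 0 + ket4 0 1 0 1 - ket4 1 0 0 0 - ket4 1 1 1 1),
    (1 / 2 : ℂ) • (ket4 0 0 1 0 - ket4 0 1 0 1 - ket4 1 0 0 0 + ket4 1 1 1 1),
    (1 / 2 : ℂ) • (ket4 0 0 1 1 + ket4 0 1 0 0 + ket4 1 0 0 1 + ket4 1 1 1 0),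
    (1 / 2 : ℂ) • (ket4 0 0 1 1 - ket4 0 1 0 0 + ket4 1 0 0 1 - ket4 1 1 1 0),
    (1 / 2 : ℂ) • (ket4 0 0 1 1 + ket4 0 1 0 0 - ket4 1 0 0 1 - ket4 1 1 1 0),
    (1 / 2 : ℂ) • (ket4 0 0 1 1 - ket4 0 1 0 0 - ket4 1 0 0 1 + ket4 1 1 1 0)]

/-!
The joint Kraus operators of an LOCC protocol are product operators, so an LOCC protocol assigns
nonnegative weights to every block positive `W`, and in total at most `tr W`. Hence if one such `W`
dominates, in all product vectors, every state that the protocol identifies with certainty, there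
are at most `tr W` of these states.

When the four parties are not all in one laboratory, the laboratories can be divided into two groups
such that every state `G4 i` reduces on one group to a density matrix of norm at most `1 / 2`. By
Cauchy-Schwarz, `W = 2⁻ᵏ` then dominates the tensor products of `k` of the states, and their
averages over orderings. Its trace is `2⁻ᵏ * 2⁴ᵏ = 2³ᵏ`, too little for all `k`-element subsets. A
laboratory that holds all qubits measures in an orthonormal basis that contains the tensor products.
-/

open scoped ComplexOrder MatrixOrder

section TensorOp

variable {L : Type} [Fintype L] {X Y Z : L → Type}

lemma tensorOp_mul [DecidableEq L] [∀ l, Fintype (Y l)] (F : ∀ l, Matrix (Z l) (Y l) ℂ)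
    (K : ∀ l, Matrix (Y l) (X l) ℂ) :
    tensorOp F * tensorOp K = tensorOp fun l => F l * K l := by
  ext z x
  simp only [tensorOp, mul_apply, of_apply, ← Finset.prod_mul_distrib, Fintype.prod_sum]

lemma tensorOp_conjTranspose (K : ∀ l, Matrix (Y l) (X l) ℂ) :
    (tensorOp K)ᴴ = tensorOp fun l => (K l)ᴴ := by
  ext x y
  simp only [tensorOp, conjTranspose_apply, of_apply, star_prod]

lemma tensorOp_sum [DecidableEq L] {κ : L → Type} [∀ l, Fintype (κ l)]
    (K : ∀ l, κ l → Matrix (Y l) (X l) ℂ) :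
    tensorOp (fun l => ∑ i, K l i) = ∑ j : ∀ l, κ l, tensorOp fun l => K l (j l) := by
  ext y x
  simp only [tensorOp, of_apply, Matrix.sum_apply, Fintype.prod_sum]

lemma tensorOp_smul (t : L → ℝ) (K : ∀ l, Matrix (Y l) (X l) ℂ) :
    tensorOp (fun l => t l • K l) = (∏ l, t l) • tensorOp K := by
  ext y x
  simp only [tensorOp, of_apply, Matrix.smul_apply, Complex.real_smul, Finset.prod_mul_distrib,
    Complex.ofReal_prod]

lemma tensorOp_one [∀ l, DecidableEq (X l)] [DecidableEq (∀ l, X l)] :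
    tensorOp (fun l => (1 : Matrix (X l) (X l) ℂ)) = 1 := by
  ext x y
  simp only [tensorOp, of_apply, one_apply, Finset.prod_ite_zero, Finset.prod_const_one,
    Finset.mem_univ, true_imp_iff, funext_iff]

lemma tensorOp_nonneg [∀ l, Finite (X l)] {A : ∀ l, Matrix (X l) (X l) ℂ}
    (hA : ∀ l, 0 ≤ A l) : 0 ≤ tensorOp A := by
  classical
  have := fun l => Fintype.ofFinite (X l)
  choose R hR using fun l => CStarAlgebra.nonneg_iff_eq_star_mul_self.mp (hA l)
  have hfactor : tensorOp A = (tensorOp R)ᴴ * tensorOp R := by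
    rw [tensorOp_conjTranspose, tensorOp_mul]
    exact congrArg tensorOp (funext hR)
  exact hfactor ▸ (posSemidef_conjTranspose_mul_self _).nonneg

lemma tensorOp_mono [∀ l, Finite (X l)] {A B : ∀ l, Matrix (X l) (X l) ℂ}
    (hA : ∀ l, 0 ≤ A l) (hAB : ∀ l, A l ≤ B l) : tensorOp A ≤ tensorOp B := by
  classical
  let C (l : L) : Bool → Matrix (X l) (X l) ℂ := fun b => if b then A l else B l - A l
  have hC : ∀ l b, 0 ≤ C l b := fun l b => by
    cases b
    · exact sub_nonneg.mpr (hAB l)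
    · exact hA l
  calc tensorOp A = tensorOp fun l => C l true := rfl
    _ ≤ ∑ j : L → Bool, tensorOp fun l => C l (j l) :=
        Finset.single_le_sum (f := fun j : L → Bool => tensorOp fun l => C l (j l))
          (fun j _ => tensorOp_nonneg fun l => hC l (j l)) (Finset.mem_univ fun _ => true)
    _ = tensorOp B := by
        rw [← tensorOp_sum]
        simp [C]

lemma sum_conjTranspose_tensorOp_mul [DecidableEq L] [∀ l, DecidableEq (X l)]
    [DecidableEq (∀ l, X l)] {κ : L → Type} [∀ l, Fintype (κ l)] {d : ∀ l, κ l → Type}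
    [∀ l i, Fintype (d l i)] {K : ∀ l (i : κ l), Matrix (d l i) (X l) ℂ}
    (complete : ∀ l, ∑ i, (K l i)ᴴ * K l i = 1) :
    ∑ j : ∀ l, κ l, (tensorOp fun l => K l (j l))ᴴ * (tensorOp fun l => K l (j l)) = 1 := by
  simp only [tensorOp_conjTranspose, tensorOp_mul]
  rw [← tensorOp_sum fun l i => (K l i)ᴴ * K l i, funext complete, tensorOp_one]

end TensorOp

lemma sum_trace_mul_mul_conjTranspose {κ m : Type*} {n : κ → Type*} [Fintype κ] [Fintype m]
    [DecidableEq m] [∀ i, Fintype (n i)] {K : ∀ i, Matrix (n i) m ℂ}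
    (complete : ∑ i, (K i)ᴴ * K i = 1) (ρ : Matrix m m ℂ) :
    ∑ i, (K i * ρ * (K i)ᴴ).trace = ρ.trace := by
  calc ∑ i, (K i * ρ * (K i)ᴴ).trace = ∑ i, ((K i)ᴴ * K i * ρ).trace :=
        Finset.sum_congr rfl fun i _ => by rw [trace_mul_comm, ← Matrix.mul_assoc]
    _ = ρ.trace := by rw [← trace_sum, ← Finset.sum_mul, complete, one_mul]

section BlockPositive

variable {L : Type} [Fintype L] {X Y : L → Type}

/-- The product vector `⨂ l, u l` of the local vectors `u l`. -/
def productVec (u : ∀ l, X l → ℂ) : (∀ l, X l) → ℂ :=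
  fun x => ∏ l, u l (x l)

lemma tensorOp_mulVec_productVec [DecidableEq L] [∀ l, Fintype (X l)]
    (K : ∀ l, Matrix (Y l) (X l) ℂ) (u : ∀ l, X l → ℂ) :
    tensorOp K *ᵥ productVec u = productVec fun l => K l *ᵥ u l := by
  ext y
  simp only [tensorOp, productVec, mulVec, dotProduct, of_apply, ← Finset.prod_mul_distrib,
    Fintype.prod_sum]

lemma productVec_single [∀ l, DecidableEq (X l)] [DecidableEq (∀ l, X l)] (x : ∀ l, X l) :
    productVec (fun l => Pi.single (x l) (1 : ℂ)) = Pi.single x 1 := by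
  ext y
  simp only [productVec, Pi.single_apply, Finset.prod_ite_zero, Finset.prod_const_one,
    Finset.mem_univ, true_imp_iff, funext_iff]

variable [DecidableEq L] [∀ l, Fintype (X l)] [∀ l, Fintype (Y l)]

/-- Block positivity: `W` has nonnegative expectation in every product vector. As only
the real part of the expectation is constrained, `W` need not be Hermitian. -/
def BlockPositive (W : Matrix (∀ l, X l) (∀ l, X l) ℂ) : Prop :=
  ∀ u : ∀ l, X l → ℂ, 0 ≤ (star (productVec u) ⬝ᵥ W *ᵥ productVec u).re

namespace BlockPositive

variable {W : Matrix (∀ l, X l) (∀ l, X l) ℂ}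

lemma of_nonneg (hW : 0 ≤ W) : BlockPositive W := fun _ =>
  (Complex.nonneg_iff.mp (hW.posSemidef.dotProduct_mulVec_nonneg _)).1

lemma smul {t : ℝ} (ht : 0 ≤ t) (hW : BlockPositive W) : BlockPositive (t • W) := fun u => by
  rw [smul_mulVec, dotProduct_smul, Complex.smul_re]
  exact smul_nonneg ht (hW u)

lemma sum {κ : Type*} {s : Finset κ} {W : κ → Matrix (∀ l, X l) (∀ l, X l) ℂ}
    (hW : ∀ i ∈ s, BlockPositive (W i)) : BlockPositive (∑ i ∈ s, W i) := fun u => by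
  rw [sum_mulVec, dotProduct_sum, Complex.re_sum]
  exact Finset.sum_nonneg fun i hi => hW i hi u

lemma conj (hW : BlockPositive W) (K : ∀ l, Matrix (Y l) (X l) ℂ) :
    BlockPositive (tensorOp K * W * (tensorOp K)ᴴ) := fun u => by
  have h := hW fun l => (K l)ᴴ *ᵥ u l
  rwa [← tensorOp_mulVec_productVec, ← tensorOp_conjTranspose, star_mulVec,
    conjTranspose_conjTranspose, ← dotProduct_mulVec, mulVec_mulVec, mulVec_mulVec] at h

lemma re_trace_nonneg (hW : BlockPositive W) : 0 ≤ W.trace.re := by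
  classical
  rw [trace, Complex.re_sum]
  refine Finset.sum_nonneg fun x _ => ?_
  simpa [productVec_single] using hW fun l => Pi.single (x l) 1

end BlockPositive

end BlockPositive

namespace LOCC

variable {L O : Type} [Fintype L] [DecidableEq L] [DecidableEq O] {X : L → Type}

lemma prob_sub (π : LOCC L O X) (o : O) : ∀ [∀ l, Fintype (X l)]
    (ρ σ : Matrix (∀ l, X l) (∀ l, X l) ℂ), π.prob o (ρ - σ) = π.prob o ρ - π.prob o σ := by
  induction π with
  | answer o' =>
    intro _ ρ σ
    simp only [prob, trace_sub, Complex.sub_re]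
    split_ifs <;> simp
  | round _ _ _ _ _ ih =>
    intro _ ρ σ
    simp only [prob, Matrix.mul_sub, Matrix.sub_mul, ih, Finset.sum_sub_distrib]

lemma prob_nonneg_of_blockPositive (π : LOCC L O X) (o : O) : ∀ [∀ l, Fintype (X l)]
    {W : Matrix (∀ l, X l) (∀ l, X l) ℂ}, BlockPositive W → 0 ≤ π.prob o W := by
  induction π with
  | answer o' =>
    intro _ W hW
    simp only [prob]
    split_ifs
    exacts [hW.re_trace_nonneg, le_rfl]
  | round _ _ _ _ _ ih =>
    intro _ W hW
    exact Finset.sum_nonneg fun j _ => ih j (hW.conj _)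

lemma sum_prob_le_re_trace (π : LOCC L O X) (S : Finset O) : ∀ [∀ l, Fintype (X l)]
    {W : Matrix (∀ l, X l) (∀ l, X l) ℂ}, BlockPositive W → ∑ o ∈ S, π.prob o W ≤ W.trace.re := by
  classical
  induction π with
  | answer o' =>
    intro _ W hW
    simp only [prob, Finset.sum_ite_eq]
    split_ifs
    exacts [le_rfl, hW.re_trace_nonneg]
  | round _ _ _ complete _ ih =>
    intro _ W hW
    simp only [prob]
    rw [Finset.sum_comm,
      ← sum_trace_mul_mul_conjTranspose (sum_conjTranspose_tensorOp_mul complete) W, Complex.re_sum]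
    exact Finset.sum_le_sum fun j _ => ih j (hW.conj _)

lemma card_le_re_trace_of_prob_eq_one [∀ l, Fintype (X l)] (π : LOCC L O X) {S : Finset O}
    {ρ : O → Matrix (∀ l, X l) (∀ l, X l) ℂ} {W : Matrix (∀ l, X l) (∀ l, X l) ℂ}
    (hW : BlockPositive W) (hρ : ∀ o ∈ S, BlockPositive (W - ρ o))
    (hπ : ∀ o ∈ S, π.prob o (ρ o) = 1) : (S.card : ℝ) ≤ W.trace.re := by
  have one_le_prob : ∀ o ∈ S, 1 ≤ π.prob o W := fun o ho => by
    have h := π.prob_nonneg_of_blockPositive o (hρ o ho)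
    rw [prob_sub, hπ o ho] at h
    exact sub_nonneg.mp h
  calc (S.card : ℝ) = ∑ o ∈ S, 1 := by simp
    _ ≤ ∑ o ∈ S, π.prob o W := Finset.sum_le_sum one_le_prob
    _ ≤ W.trace.re := π.sum_prob_le_re_trace S hW

end LOCC

lemma sum_norm_sq_eq_re_dotProduct_star {n : Type*} [Fintype n] (v : n → ℂ) :
    ∑ i, ‖v i‖ ^ 2 = (v ⬝ᵥ star v).re := by
  simp [dotProduct, Complex.mul_conj', ← Complex.ofReal_pow]

lemma norm_sq_star_dotProduct_mulVec_le {m n : Type*} [Fintype m] [DecidableEq m] [Fintype n]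
    {M : Matrix m n ℂ} {c : ℝ} (hM : M * Mᴴ ≤ c • 1) (f : m → ℂ) (g : n → ℂ) :
    ‖star f ⬝ᵥ M *ᵥ g‖ ^ 2 ≤ c * (∑ a, ‖f a‖ ^ 2) * ∑ b, ‖g b‖ ^ 2 := by
  have row_norm_le : ∑ b, ‖(star f ᵥ* M) b‖ ^ 2 ≤ c * ∑ a, ‖f a‖ ^ 2 := by
    have h := (Complex.nonneg_iff.mp ((le_iff.mp hM).dotProduct_mulVec_nonneg f)).1
    rw [sub_mulVec, smul_mulVec, one_mulVec, dotProduct_sub, dotProduct_smul, Complex.sub_re,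
      Complex.smul_re, dotProduct_comm _ f, ← sum_norm_sq_eq_re_dotProduct_star,
      ← mulVec_mulVec, dotProduct_mulVec] at h
    rw [sum_norm_sq_eq_re_dotProduct_star, star_vecMul, star_star]
    exact sub_nonneg.mp h
  calc ‖star f ⬝ᵥ M *ᵥ g‖ ^ 2 = ‖∑ b, (star f ᵥ* M) b * g b‖ ^ 2 := by
        rw [dotProduct_mulVec]; rfl
    _ ≤ (∑ b, ‖(star f ᵥ* M) b‖ * ‖g b‖) ^ 2 := by
        gcongr
        exact norm_sum_le_of_le _ fun b _ => norm_mul_le _ _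
    _ ≤ (∑ b, ‖(star f ᵥ* M) b‖ ^ 2) * ∑ b, ‖g b‖ ^ 2 := Finset.sum_mul_sq_le_sq_mul_sq _ _ _
    _ ≤ c * (∑ a, ‖f a‖ ^ 2) * ∑ b, ‖g b‖ ^ 2 := by gcongr

section ReducedState

/-- The amplitudes of the joint vector `v` as a matrix across the cut between the systems `i` with
`B i` (rows) and the remaining ones (columns). -/
def cutMatrix {I : Type} {X : I → Type} (B : I → Prop) [DecidablePred B] (v : (∀ i, X i) → ℂ) :
    Matrix (∀ i : {i // B i}, X i) (∀ i : {i // ¬ B i}, X i) ℂ :=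
  of fun a b => v ((Equiv.piEquivPiSubtypeProd B X).symm (a, b))

variable {I : Type} [Fintype I] [DecidableEq I] {X : I → Type} [∀ i, Fintype (X i)]

/-- The density matrix of the systems `i` with `B i` when all systems together are in the state
`v`: the partial trace of `v v*` over the remaining systems. -/
def reducedState (B : I → Prop) [DecidablePred B] (v : (∀ i, X i) → ℂ) :
    Matrix (∀ i : {i // B i}, X i) (∀ i : {i // B i}, X i) ℂ :=
  cutMatrix B v * (cutMatrix B v)ᴴ

lemma reducedState_nonneg (B : I → Prop) [DecidablePred B] (v : (∀ i, X i) → ℂ) :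
    0 ≤ reducedState B v :=
  (posSemidef_self_mul_conjTranspose _).nonneg

variable {B : I → Prop} [DecidablePred B] [∀ i, DecidableEq (X i)]

lemma reducedState_eq_diagonal {v : (∀ i, X i) → ℂ}
    (hv : ∀ x y, v x ≠ 0 → v y ≠ 0 → (∀ i, ¬ B i → x i = y i) → x = y) :
    reducedState B v = diagonal fun a => ((∑ b, ‖cutMatrix B v a b‖ ^ 2 : ℝ) : ℂ) := by
  ext a a'
  simp only [reducedState, mul_apply, conjTranspose_apply]
  obtain rfl | ha := eq_or_ne a a'
  · simp only [diagonal_apply_eq, Complex.ofReal_sum, Complex.ofReal_pow, Complex.star_def,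
      Complex.mul_conj']
  · rw [diagonal_apply_ne _ ha]
    refine Finset.sum_eq_zero fun b _ => ?_
    by_contra hne
    obtain ⟨h, h'⟩ := mul_ne_zero_iff.mp hne
    have heq := hv _ _ h (star_ne_zero.mp h') fun i hi => by
      simp [Equiv.piEquivPiSubtypeProd, hi]
    exact ha (congrArg Prod.fst ((Equiv.piEquivPiSubtypeProd B X).symm.injective heq))

lemma reducedState_le_smul_one {v : (∀ i, X i) → ℂ} {c : ℝ}
    (hv : ∀ x y, v x ≠ 0 → v y ≠ 0 → (∀ i, ¬ B i → x i = y i) → x = y)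
    (hc : ∀ a, ∑ b, ‖cutMatrix B v a b‖ ^ 2 ≤ c) : reducedState B v ≤ c • 1 := by
  rw [reducedState_eq_diagonal hv, ← diagonal_one, ← diagonal_smul, le_iff, diagonal_sub,
    posSemidef_diagonal_iff]
  intro a
  simpa [Complex.real_smul] using
    (sub_nonneg.mpr (Complex.real_le_real.mpr (hc a)) : (0 : ℂ) ≤ (c : ℂ) - _)

end ReducedState

section Cut

variable {I : Type} [Fintype I] {X : I → Type} {B : I → Prop} [DecidablePred B]

lemma productVec_piEquivPiSubtypeProd_symm (u : ∀ i, X i → ℂ) (a : ∀ i : {i // B i}, X i)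
    (b : ∀ i : {i // ¬ B i}, X i) :
    productVec u ((Equiv.piEquivPiSubtypeProd B X).symm (a, b)) =
      productVec (fun i : {i // B i} => u i) a * productVec (fun i : {i // ¬ B i} => u i) b := by
  rw [productVec, ← Fintype.prod_subtype_mul_prod_subtype B]
  congr 1 <;> exact Finset.prod_congr rfl fun i _ => by simp [Equiv.piEquivPiSubtypeProd, i.2]

variable [DecidableEq I] [∀ i, Fintype (X i)]

lemma sum_eq_sum_sum_piEquivPiSubtypeProd_symm {M : Type*} [AddCommMonoid M]
    (F : (∀ i, X i) → M) :
    ∑ x, F x = ∑ a, ∑ b, F ((Equiv.piEquivPiSubtypeProd B X).symm (a, b)) := by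
  rw [← Fintype.sum_prod_type', Equiv.sum_comp]

lemma star_productVec_dotProduct (u : ∀ i, X i → ℂ) (v : (∀ i, X i) → ℂ) :
    star (productVec u) ⬝ᵥ v = star (productVec fun i : {i // B i} => u i) ⬝ᵥ
      cutMatrix B v *ᵥ star (productVec fun i : {i // ¬ B i} => u i) := by
  rw [dotProduct, sum_eq_sum_sum_piEquivPiSubtypeProd_symm (B := B)]
  simp only [dotProduct, mulVec, Pi.star_apply, productVec_piEquivPiSubtypeProd_symm, star_mul',
    Finset.mul_sum, cutMatrix, of_apply]
  exact Finset.sum_congr rfl fun a _ => Finset.sum_congr rfl fun b _ => by ring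

lemma sum_norm_sq_productVec (u : ∀ i, X i → ℂ) :
    ∑ x, ‖productVec u x‖ ^ 2 = (∑ a, ‖productVec (fun i : {i // B i} => u i) a‖ ^ 2) *
      ∑ b, ‖productVec (fun i : {i // ¬ B i} => u i) b‖ ^ 2 := by
  rw [sum_eq_sum_sum_piEquivPiSubtypeProd_symm (B := B)]
  simp only [productVec_piEquivPiSubtypeProd_symm, norm_mul, mul_pow, Finset.sum_mul_sum]

lemma blockPositive_sub_vecMulVec [∀ i, DecidableEq (X i)] {v : (∀ i, X i) → ℂ} {c : ℝ}
    (hv : reducedState B v ≤ c • 1) : BlockPositive (c • 1 - vecMulVec v (star v)) := fun u => by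
  have hle : ‖star (productVec u) ⬝ᵥ v‖ ^ 2 ≤ c * ∑ x, ‖productVec u x‖ ^ 2 := by
    rw [star_productVec_dotProduct (B := B), sum_norm_sq_productVec (B := B), ← mul_assoc]
    simpa only [Pi.star_apply, norm_star] using norm_sq_star_dotProduct_mulVec_le hv
      (productVec fun i : {i // B i} => u i) (star (productVec fun i : {i // ¬ B i} => u i))
  rw [sub_mulVec, smul_mulVec, one_mulVec, vecMulVec_mulVec, dotProduct_sub, dotProduct_smul,
    dotProduct_comm _ (productVec u), Complex.sub_re, Complex.smul_re,
    ← sum_norm_sq_eq_re_dotProduct_star, sub_nonneg]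
  rw [star_dotProduct v (productVec u), dotProduct_smul]
  simpa [Complex.mul_conj', ← Complex.ofReal_pow] using hle

end Cut

lemma card_fin_equiv {ι : Type*} [DecidableEq ι] {k : ℕ} {s : Finset ι} (hs : s.card = k) :
    Fintype.card (Fin k ≃ s) = k.factorial := by
  rw [Fintype.card_equiv (s.equivFinOfCardEq hs).symm, Fintype.card_fin]

section Copies

variable {P L ι : Type}

/-- The bits of all laboratories, arranged by copy instead of by laboratory. -/
def copiesEquiv (lab : P → L) (k : ℕ) :
    (∀ l, LabSystem lab k l) ≃ (Fin k → P → Fin 2) where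
  toFun x c p := x (lab p) c ⟨p, rfl⟩
  invFun w _ c p := w c p
  left_inv x := by
    refine funext fun l => funext fun c => funext ?_
    rintro ⟨p, rfl⟩
    rfl
  right_inv _ := rfl

/-- The bits of the laboratories in `C`, arranged by copy instead of by laboratory. -/
def copiesOnEquiv (lab : P → L) (k : ℕ) (C : L → Prop) :
    (∀ l : {l // C l}, LabSystem lab k l) ≃ (Fin k → {p // C (lab p)} → Fin 2) where
  toFun x c p := x ⟨lab p, p.2⟩ c ⟨p, rfl⟩
  invFun w l c p := w c ⟨p, p.2.symm ▸ l.2⟩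
  left_inv x := by
    refine funext fun ⟨l, hl⟩ => funext fun c => funext ?_
    rintro ⟨p, rfl : lab p = l⟩
    rfl
  right_inv _ := rfl

variable {ψ : ι → (P → Fin 2) → ℂ} {lab : P → L} {k : ℕ} {B : L → Prop} [DecidablePred B]

lemma cutMatrix_orderedState (a : Fin k → ι) :
    cutMatrix B (orderedState ψ lab a) =
      (tensorOp fun c => cutMatrix (fun p => B (lab p)) (ψ (a c))).submatrix
        (copiesOnEquiv lab k B) (copiesOnEquiv lab k fun l => ¬ B l) := by
  ext x y
  simp only [cutMatrix, orderedState, tensorOp, submatrix_apply, of_apply]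
  refine Finset.prod_congr rfl fun c _ => congrArg (ψ (a c)) (funext fun p => ?_)
  by_cases hp : B (lab p) <;> simp [Equiv.piEquivPiSubtypeProd, copiesOnEquiv, hp]

variable [Fintype P] [DecidableEq P] [Fintype L] [DecidableEq L]

lemma reducedState_orderedState (a : Fin k → ι) :
    reducedState B (orderedState ψ lab a) =
      (tensorOp fun c => reducedState (fun p => B (lab p)) (ψ (a c))).submatrix
        (copiesOnEquiv lab k B) (copiesOnEquiv lab k B) := by
  rw [reducedState, cutMatrix_orderedState, conjTranspose_submatrix, submatrix_mul_equiv,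
    tensorOp_conjTranspose, tensorOp_mul]
  rfl

lemma reducedState_orderedState_le {a : Fin k → ι} {c : ℝ}
    (h : ∀ j, reducedState (fun p => B (lab p)) (ψ (a j)) ≤ c • 1) :
    reducedState B (orderedState ψ lab a) ≤ c ^ k • 1 := by
  have hle : (tensorOp fun j => reducedState (fun p => B (lab p)) (ψ (a j))) ≤ c ^ k • 1 := by
    refine (tensorOp_mono (fun j => reducedState_nonneg _ _) h).trans_eq ?_
    rw [tensorOp_smul, tensorOp_one, Finset.prod_const, Finset.card_fin]
  rw [reducedState_orderedState, ← submatrix_one_equiv (copiesOnEquiv lab k B), le_iff]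
  exact (le_iff.mp hle).submatrix (copiesOnEquiv lab k B)

lemma blockPositive_sub_subsetState [DecidableEq ι] {s : Finset ι} (hs : s.card = k) {c : ℝ}
    (h : ∀ i ∈ s, reducedState (fun p => B (lab p)) (ψ i) ≤ c • 1) :
    BlockPositive (c ^ k • 1 - subsetState ψ lab k s) := by
  have haverage : c ^ k • 1 - subsetState ψ lab k s = ((k.factorial : ℝ))⁻¹ • ∑ e : Fin k ≃ s,
      (c ^ k • 1 - vecMulVec (orderedState ψ lab fun j => (e j : ι))
        (star (orderedState ψ lab fun j => (e j : ι)))) := by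
    have hk : (k.factorial : ℝ) ≠ 0 := by positivity
    rw [Finset.sum_sub_distrib, smul_sub, Finset.sum_const, Finset.card_univ,
      card_fin_equiv hs, ← Nat.cast_smul_eq_nsmul ℝ, inv_smul_smul₀ hk, subsetState]
    congr 1
    ext
    simp
  rw [haverage]
  exact BlockPositive.smul (by positivity) <| BlockPositive.sum fun e _ =>
    blockPositive_sub_vecMulVec (reducedState_orderedState_le fun j => h _ (e j).2)

lemma card_labSystems :
    Fintype.card (∀ l, LabSystem lab k l) = (2 ^ Fintype.card P) ^ k := by
  rw [Fintype.card_congr (copiesEquiv lab k)]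
  simp only [Fintype.card_fun, Fintype.card_fin]

theorem LocallyIdentifiable.choose_card_le [DecidableEq ι] {T : Finset ι}
    (hT : LocallyIdentifiable ψ lab T k) {c : ℝ} (hc : 0 ≤ c)
    (h : ∀ i ∈ T, reducedState (fun p => B (lab p)) (ψ i) ≤ c • 1) :
    (T.card.choose k : ℝ) ≤ (c * 2 ^ Fintype.card P) ^ k := by
  obtain ⟨π, hπ⟩ := hT
  have hW : BlockPositive (c ^ k • (1 : Matrix (∀ l, LabSystem lab k l) _ ℂ)) :=
    BlockPositive.smul (by positivity) (BlockPositive.of_nonneg PosSemidef.one.nonneg)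
  have hle := π.card_le_re_trace_of_prob_eq_one hW (fun s hs => ?_) hπ
  · rw [Finset.card_powersetCard, trace_smul, trace_one, card_labSystems] at hle
    refine hle.trans_eq ?_
    rw [Complex.smul_re, Complex.natCast_re, smul_eq_mul, mul_pow]
    push_cast
    rfl
  · obtain ⟨hsT, hs⟩ := Finset.mem_powersetCard.mp hs
    exact blockPositive_sub_subsetState hs fun i hi => h i (hsT hi)

end Copies

section SingleLab

variable {L : Type} [DecidableEq L] {X : L → Type} {A : Type*}

/-- Kraus operators of the round in which the laboratory `l₀`, the only one with a nontrivial
system, measures the whole system in the family `φ`. The others always announce the outcome `a₀`,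
which keeps the set of outcomes the same in all laboratories. -/
noncomputable def singleLabKraus [DecidableEq A] [∀ l, Nonempty (X l)] (φ : A → (∀ l, X l) → ℂ)
    (l₀ : L) (a₀ : A) : ∀ l, A → Matrix (Fin 1) (X l) ℂ :=
  Function.update (fun _ a => of fun _ _ => if a = a₀ then 1 else 0) l₀
    fun a => of fun _ x => star (φ a (Function.update (fun l => Classical.arbitrary (X l)) l₀ x))

variable [∀ l, Nonempty (X l)] {φ : A → (∀ l, X l) → ℂ} {l₀ : L}

lemma sum_conjTranspose_singleLabKraus_mul [Fintype A] [DecidableEq A]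
    [DecidableEq (∀ l, X l)] [∀ l, DecidableEq (X l)]
    (complete : ∑ a, vecMulVec (φ a) (star (φ a)) = 1)
    (hX : ∀ l ≠ l₀, Subsingleton (X l)) (a₀ : A) (l : L) :
    ∑ a, (singleLabKraus φ l₀ a₀ l a)ᴴ * singleLabKraus φ l₀ a₀ l a = 1 := by
  ext x y
  simp only [Matrix.sum_apply, mul_apply, Fin.sum_univ_one, conjTranspose_apply]
  obtain rfl | hl := eq_or_ne l l₀
  · have h := congrFun₂ complete (Function.update (fun l => Classical.arbitrary (X l)) l x)
      (Function.update (fun l => Classical.arbitrary (X l)) l y)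
    simpa [singleLabKraus, Matrix.sum_apply, vecMulVec_apply, one_apply,
      (Function.update_injective _ l).eq_iff] using h
  · have := hX l hl
    obtain rfl := Subsingleton.elim x y
    simp [singleLabKraus, hl]

lemma tensorOp_singleLabKraus [DecidableEq A] [Fintype L]
    (hX : ∀ l ≠ l₀, Subsingleton (X l)) (a₀ : A) (j : L → A) :
    tensorOp (fun l => singleLabKraus φ l₀ a₀ l (j l)) =
      (∏ l ∈ Finset.univ.erase l₀, if j l = a₀ then (1 : ℂ) else 0) •
        of fun _ => star (φ (j l₀)) := by
  ext y x
  have update_eq : Function.update (fun l => Classical.arbitrary (X l)) l₀ (x l₀) = x := by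
    funext l
    obtain rfl | hl := eq_or_ne l l₀
    · exact Function.update_self ..
    · exact (hX l hl).elim _ _
  rw [tensorOp, of_apply, ← Finset.prod_erase_mul _ _ (Finset.mem_univ l₀), Matrix.smul_apply,
    smul_eq_mul]
  congr 1
  · exact Finset.prod_congr rfl fun l hl => by simp [singleLabKraus, Finset.ne_of_mem_erase hl]
  · simp [singleLabKraus, update_eq]

lemma LOCC.exists_prob_eq_re_trace_of_subsingleton [Fintype L] [∀ l, Fintype (X l)] [Fintype A]
    [DecidableEq (∀ l, X l)] (complete : ∑ a, vecMulVec (φ a) (star (φ a)) = 1)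
    (hX : ∀ l ≠ l₀, Subsingleton (X l)) {O : Type} [DecidableEq O] (f : A → O) :
    ∃ π : LOCC L O X, ∀ o ρ, (∀ a, f a ≠ o → star (φ a) ᵥ* ρ = 0) → π.prob o ρ = ρ.trace.re := by
  classical
  obtain ⟨a₀⟩ : Nonempty A := by
    by_contra hA
    rw [not_nonempty_iff] at hA
    rw [Finset.univ_eq_empty, Finset.sum_empty] at complete
    exact zero_ne_one complete
  let en : Fin (Fintype.card A) ≃ A := (Fintype.equivFin A).symm
  have complete' (l : L) : ∑ i, (singleLabKraus φ l₀ a₀ l (en i))ᴴ *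
      singleLabKraus φ l₀ a₀ l (en i) = 1 := by
    rw [en.sum_comp fun a => (singleLabKraus φ l₀ a₀ l a)ᴴ * singleLabKraus φ l₀ a₀ l a]
    exact sum_conjTranspose_singleLabKraus_mul complete hX a₀ l
  refine ⟨.round (fun _ => Fintype.card A) (fun _ _ => 1)
    (fun l i => singleLabKraus φ l₀ a₀ l (en i)) complete' fun j => .answer (f (en (j l₀))),
    fun o ρ hρ => ?_⟩
  simp only [prob]
  rw [← sum_trace_mul_mul_conjTranspose (sum_conjTranspose_tensorOp_mul complete') ρ,
    Complex.re_sum]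
  refine Finset.sum_congr rfl fun j _ => ?_
  split_ifs with hj
  · rfl
  · have wrong_outcome_eq_zero :
        tensorOp (fun l => singleLabKraus φ l₀ a₀ l (en (j l))) * ρ = 0 := by
      rw [tensorOp_singleLabKraus hX a₀ fun l => en (j l), Matrix.smul_mul]
      ext _ x
      exact mul_eq_zero_of_right _ (congrFun (hρ _ hj) x)
    rw [wrong_outcome_eq_zero, Matrix.zero_mul, trace_zero, Complex.zero_re]

end SingleLab

lemma sum_vecMulVec_orthonormalBasis {A n : Type*} [Fintype A] [Fintype n] [DecidableEq n]
    (b : OrthonormalBasis A ℂ (EuclideanSpace ℂ n)) :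
    ∑ a, vecMulVec (b a).ofLp (star (b a).ofLp) = 1 := by
  ext x y
  have h := b.sum_inner_mul_inner (EuclideanSpace.single x 1) (EuclideanSpace.single y 1)
  simpa [Matrix.sum_apply, vecMulVec_apply, one_apply, EuclideanSpace.inner_single_left,
    EuclideanSpace.inner_single_right, Pi.single_apply, eq_comm] using h

section OrthonormalStates

variable {P L ι : Type} [Fintype P] [DecidableEq P] [Fintype L] [DecidableEq L]
  {ψ : ι → (P → Fin 2) → ℂ}

lemma orderedState_dotProduct_star (lab : P → L) {k : ℕ} (a b : Fin k → ι) :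
    orderedState ψ lab a ⬝ᵥ star (orderedState ψ lab b) = ∏ c, ψ (a c) ⬝ᵥ star (ψ (b c)) := by
  simp only [dotProduct, Fintype.prod_sum, Pi.star_apply]
  refine Fintype.sum_equiv (copiesEquiv lab k) _ _ fun x => ?_
  simp only [orderedState, star_prod, ← Finset.prod_mul_distrib]
  rfl

lemma orthonormal_orderedState (hψ : Orthonormal ℂ fun i => WithLp.toLp 2 (ψ i)) (lab : P → L)
    (k : ℕ) : Orthonormal ℂ fun a : Fin k → ι => WithLp.toLp 2 (orderedState ψ lab a) := by
  classical
  rw [orthonormal_iff_ite] at hψ ⊢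
  intro a b
  simp only [EuclideanSpace.inner_toLp_toLp] at hψ ⊢
  simp only [orderedState_dotProduct_star, hψ, Finset.prod_ite_zero, Finset.prod_const_one,
    Finset.mem_univ, true_imp_iff, funext_iff]

variable [DecidableEq ι]

lemma trace_subsetState (hψ : Orthonormal ℂ fun i => WithLp.toLp 2 (ψ i)) (lab : P → L) {k : ℕ}
    {s : Finset ι} (hs : s.card = k) : (subsetState ψ lab k s).trace = 1 := by
  have norm_eq_one (a : Fin k → ι) : orderedState ψ lab a ⬝ᵥ star (orderedState ψ lab a) = 1 := by
    rw [← EuclideanSpace.inner_toLp_toLp, inner_self_eq_norm_sq_to_K,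
      (orthonormal_orderedState hψ lab k).1 a]
    simp
  simp only [subsetState, trace_smul, trace_sum, trace_vecMulVec, norm_eq_one]
  rw [Finset.sum_const, Finset.card_univ, card_fin_equiv hs, nsmul_one, smul_eq_mul]
  exact inv_mul_cancel₀ (Nat.cast_ne_zero.mpr k.factorial_ne_zero)

lemma vecMul_subsetState_eq_zero {lab : P → L} {k : ℕ} {s : Finset ι}
    {u : (∀ l, LabSystem lab k l) → ℂ}
    (h : ∀ e : Fin k ≃ s, u ⬝ᵥ orderedState ψ lab (fun c => (e c : ι)) = 0) :
    u ᵥ* subsetState ψ lab k s = 0 := by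
  simp only [subsetState, vecMul_smul, vecMul_sum, vecMul_vecMulVec, h, zero_smul,
    Finset.sum_const_zero, smul_zero]

lemma image_equiv_coe {k : ℕ} {s : Finset ι} (e : Fin k ≃ s) :
    Finset.univ.image (fun c => (e c : ι)) = s := by
  ext i
  simp only [Finset.mem_image, Finset.mem_univ, true_and]
  exact ⟨fun ⟨c, hc⟩ => hc ▸ (e c).2, fun hi => ⟨e.symm ⟨i, hi⟩, by simp⟩⟩

theorem locallyIdentifiable_of_orthonormal (hψ : Orthonormal ℂ fun i => WithLp.toLp 2 (ψ i))
    {lab : P → L} {l₀ : L} (hlab : ∀ p, lab p = l₀) (T : Finset ι) (k : ℕ) :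
    LocallyIdentifiable ψ lab T k := by
  let v := fun a : Fin k → ι => WithLp.toLp 2 (orderedState ψ lab a)
  have hv : Orthonormal ℂ v := orthonormal_orderedState hψ lab k
  obtain ⟨u, b, hu, hb⟩ := hv.toSubtypeRange.exists_orthonormalBasis_extension
  let answer := Function.extend v (fun a => Finset.univ.image a) fun _ => ∅
  have hX : ∀ l ≠ l₀, Subsingleton (LabSystem lab k l) := fun l hl => by
    have : IsEmpty {p // lab p = l} := ⟨fun p => hl (p.2.symm.trans (hlab p))⟩
    infer_instance
  obtain ⟨π, hπ⟩ := LOCC.exists_prob_eq_re_trace_of_subsingleton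
    (sum_vecMulVec_orthonormalBasis b) hX fun a => answer (b a)
  refine ⟨π, fun s hs => ?_⟩
  rw [hπ, trace_subsetState hψ lab (Finset.mem_powersetCard.mp hs).2, Complex.one_re]
  refine fun a ha => vecMul_subsetState_eq_zero fun e => ?_
  obtain ⟨a', ha'⟩ : ∃ a', b a' = v fun c => (e c : ι) :=
    ⟨⟨_, hu ⟨_, rfl⟩⟩, by rw [hb]⟩
  have hne : a ≠ a' := by
    rintro rfl
    refine ha ?_
    simp only [answer]
    rw [ha', hv.linearIndependent.injective.extend_apply, image_equiv_coe]
  have horth : inner ℂ (b a) (b a') = 0 := b.orthonormal.2 hne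
  rw [ha'] at horth
  rwa [EuclideanSpace.inner_eq_star_dotProduct, dotProduct_comm] at horth

end OrthonormalStates

section FourQubitStates

/-- The vector `2 • G4 i` with its integer coordinates, on which finite statements can be decided.
The binary digits of `i`, from the highest to the lowest, are the parity of `x 0 + x 1 + x 2` and
that of `x 1 + x 3` on the support, and the exponents of the signs `(-1) ^ x 0` and `(-1) ^ x 1`. -/
def twiceG4 (i : Fin 16) (x : Fin 4 → Fin 2) : ℤ :=
  if (x 2).val = ((x 0).val + (x 1).val + i.val / 8) % 2 ∧
      (x 3).val = ((x 1).val + i.val / 4) % 2 then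
    (-1) ^ ((x 1).val * i.val + (x 0).val * (i.val / 2)) else 0

lemma ket4_apply (a b c d : Fin 2) (x : Fin 4 → Fin 2) :
    ket4 a b c d x = ((if x = ![a, b, c, d] then 1 else 0 : ℤ) : ℂ) := by
  simp only [ket4, Pi.single_apply, Int.cast_ite, Int.cast_one, Int.cast_zero]

lemma G4_apply (i : Fin 16) (x : Fin 4 → Fin 2) : G4 i x = (1 / 2 : ℂ) * (twiceG4 i x : ℂ) := by
  fin_cases i <;>
  · simp only [G4, Fin.zero_eta, Fin.mk_one, Fin.reduceFinMk, Matrix.cons_val, Pi.smul_apply,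
      Pi.add_apply, Pi.sub_apply, ket4_apply, smul_eq_mul, ← Int.cast_add, ← Int.cast_sub]
    refine congrArg (fun z : ℤ => (1 / 2 : ℂ) * (z : ℂ)) ?_
    revert x
    decide +kernel

lemma sum_twiceG4_mul_twiceG4 :
    ∀ i j : Fin 16, ∑ x, twiceG4 i x * twiceG4 j x = if i = j then 4 else 0 := by
  decide +kernel

lemma orthonormal_G4 : Orthonormal ℂ fun i => WithLp.toLp 2 (G4 i) := by
  rw [orthonormal_iff_ite]
  intro i j
  rw [EuclideanSpace.inner_toLp_toLp]
  calc ∑ x, G4 j x * star (G4 i x)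
      = (1 / 4 : ℂ) * ((∑ x, twiceG4 i x * twiceG4 j x : ℤ) : ℂ) := by
        simp only [Int.cast_sum, Finset.mul_sum, G4_apply]
        refine Finset.sum_congr rfl fun x _ => ?_
        simp only [Int.cast_mul, Complex.star_def, map_mul, map_div₀, map_one, map_ofNat,
          map_intCast]
        ring
    _ = if i = j then 1 else 0 := by
        rw [sum_twiceG4_mul_twiceG4]
        split_ifs <;> norm_num

lemma sum_twiceG4_sq_filter : ∀ (i : Fin 16) (p : Fin 4) (v : Fin 2),
    ∑ x with x p = v, twiceG4 i x ^ 2 = 2 := by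
  decide +kernel

lemma sum_norm_sq_G4_filter (i : Fin 16) (p : Fin 4) (v : Fin 2) :
    ∑ x with x p = v, ‖G4 i x‖ ^ 2 = 1 / 2 := by
  have norm_sq_eq (x : Fin 4 → Fin 2) :
      ‖G4 i x‖ ^ 2 = (1 / 4 : ℝ) * ((twiceG4 i x ^ 2 : ℤ) : ℝ) := by
    rw [G4_apply, norm_mul, mul_pow, Complex.norm_intCast, sq_abs]
    push_cast
    norm_num
  simp only [norm_sq_eq]
  rw [← Finset.mul_sum, ← Int.cast_sum, sum_twiceG4_sq_filter]
  norm_num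

/-- The sets of qubits in which two different basis vectors in the support of a state `G4 i` may
differ. As they pairwise intersect, one side of each cut contains none of them. -/
def supportDifferences : Finset (Finset (Fin 4)) := {{0, 2}, {1, 2, 3}, {0, 1, 3}}

lemma supportDifferences_not_disjoint :
    ∀ s ∈ supportDifferences, ∀ t ∈ supportDifferences, ¬ Disjoint s t := by
  decide

lemma filter_ne_mem_supportDifferences : ∀ (i : Fin 16) (x y : Fin 4 → Fin 2), twiceG4 i x ≠ 0 →
    twiceG4 i y ≠ 0 → x ≠ y → ({p | x p ≠ y p} : Finset (Fin 4)) ∈ supportDifferences := by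
  decide +kernel

lemma sum_norm_sq_cutMatrix_G4_le {B : Fin 4 → Prop} [DecidablePred B] {r : Fin 4} (hr : B r)
    (i : Fin 16) (a : {p // B p} → Fin 2) : ∑ b, ‖cutMatrix B (G4 i) a b‖ ^ 2 ≤ 1 / 2 := by
  rw [← sum_norm_sq_G4_filter i r (a ⟨r, hr⟩), Finset.sum_filter,
    sum_eq_sum_sum_piEquivPiSubtypeProd_symm (B := B)]
  refine (Finset.sum_le_sum fun b _ => ?_).trans
    (Finset.single_le_sum (f := fun a' => ∑ b, _) (fun a' _ => Finset.sum_nonneg fun b _ => ?_)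
      (Finset.mem_univ a))
  · simp [cutMatrix, Equiv.piEquivPiSubtypeProd, hr]
  · split_ifs <;> positivity

lemma reducedState_G4_le {B : Fin 4 → Prop} [DecidablePred B] {r : Fin 4} (hr : B r)
    (hB : ∀ s ∈ supportDifferences, ∃ p ∈ s, ¬ B p) (i : Fin 16) :
    reducedState B (G4 i) ≤ (1 / 2 : ℝ) • 1 := by
  have twiceG4_ne_zero {x} (hx : G4 i x ≠ 0) : twiceG4 i x ≠ 0 :=
    fun h => hx (by simp [G4_apply, h])
  refine reducedState_le_smul_one (v := G4 i) (fun x y hx hy hxy => ?_)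
    (sum_norm_sq_cutMatrix_G4_le hr i)
  by_contra hne
  obtain ⟨p, hp, hBp⟩ := hB _
    (filter_ne_mem_supportDifferences i x y (twiceG4_ne_zero hx) (twiceG4_ne_zero hy) hne)
  exact (Finset.mem_filter.mp hp).2 (hxy p hBp)

lemma reducedState_G4_le_or {B : Fin 4 → Prop} [DecidablePred B] {q r : Fin 4} (hr : B r)
    (hq : ¬ B q) : (∀ i, reducedState B (G4 i) ≤ (1 / 2 : ℝ) • 1) ∨
      ∀ i, reducedState (fun p => ¬ B p) (G4 i) ≤ (1 / 2 : ℝ) • 1 := by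
  by_cases hB : ∀ s ∈ supportDifferences, ∃ p ∈ s, ¬ B p
  · exact .inl (reducedState_G4_le hr hB)
  · refine .inr (reducedState_G4_le hq fun t ht => ?_)
    push Not at hB ⊢
    obtain ⟨s, hs, hsB⟩ := hB
    obtain ⟨p, hps, hpt⟩ := Finset.not_disjoint_iff.mp (supportDifferences_not_disjoint s hs t ht)
    exact ⟨p, hpt, hsB p hps⟩

theorem LocallyIdentifiable.choose_card_le_of_lab_ne {L : Type} [Fintype L] [DecidableEq L]
    {lab : Fin 4 → L} {T : Finset (Fin 16)} {k : ℕ} (hT : LocallyIdentifiable G4 lab T k)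
    {q r : Fin 4} (h : lab q ≠ lab r) : T.card.choose k ≤ 2 ^ (3 * k) := by
  have hle : (T.card.choose k : ℝ) ≤ (1 / 2 * 2 ^ Fintype.card (Fin 4)) ^ k := by
    rcases reducedState_G4_le_or (B := fun p => lab p = lab r) rfl h with hB | hB
    · exact hT.choose_card_le (B := fun l => l = lab r) (by norm_num) fun i _ => hB i
    · exact hT.choose_card_le (B := fun l => ¬ l = lab r) (by norm_num) fun i _ => hB i
  rw [Fintype.card_fin, show (1 / 2 * 2 ^ 4 : ℝ) = 2 ^ 3 by norm_num, ← pow_mul] at hle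
  exact_mod_cast hle

lemma not_forall_decide_mem_eq : ∀ A : Finset (Fin 4), A.card = 1 ∨ A.card = 2 →
    ¬ ∀ p q, decide (p ∈ A) = decide (q ∈ A) := by
  decide

end FourQubitStates

theorem mainTheorem5_general {L : Type} [Fintype L] [DecidableEq L] (lab : Fin 4 → L)
    {T : Finset (Fin 16)} {k : ℕ} (hT : 2 ^ (3 * k) < T.card.choose k) :
    LocallyIdentifiable G4 lab T k ↔ ∀ p q, lab p = lab q := by
  refine ⟨fun h p q => ?_,
    fun h => locallyIdentifiable_of_orthonormal orthonormal_G4 (fun p => h p 0) T k⟩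
  by_contra hpq
  exact hT.not_ge (h.choose_card_le_of_lab_ne hpq)

theorem mainTheorem5 (D k : ℕ) (hD : 2 < D) (hD' : D ≤ 16) (hk : 1 < k) (hk' : k < D)
    (hDk : 2 ^ (3 * k) < D.choose k) (T : Finset (Fin 16)) (hT : T.card = D) :
    (∀ A : Finset (Fin 4), A.card = 1 ∨ A.card = 2 →
      ¬ LocallyIdentifiable G4 (fun p => decide (p ∈ A)) T k) ∧
    (∀ (L : Type) [Fintype L] [DecidableEq L] (lab : Fin 4 → L),
      LocallyIdentifiable G4 lab T k ↔ ∀ p q, lab p = lab q) := by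
  subst hT
  exact ⟨fun A hA h => not_forall_decide_mem_eq A hA ((mainTheorem5_general _ hDk).mp h),
    fun L _ _ lab => mainTheorem5_general lab hDk⟩
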